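/- Let $H$ be a hypergraph with vertex set $[n]$, i.e. a finite family $E(H)$ of subsets of $[n]$ (repeated, empty and one-element hyperedges are allowed), and let $\deg_H(i)$ be the number of $e \in E(H)$ with $i \in e$. A relaxed matching of $H$ is a family $M = (S_e)_{e \in E}$ with $E \subseteq E(H)$, $S_e \subseteq e$ and $|S_e| > 1$ for all $e \in E$, and $S_e \cap S_{e'} = \emptyset$ for distinct $e, e' \in E$. Put $|M| = |E|$, $V(M) = \bigcup_{e \in E} S_e$, let $m_k(M)$ be the number of $e \in E$ with $|S_e| = k$, and let $W(M) = \prod_{k=1}^{n-1} k^{m_{k+1}(M)}$. The multivariate relaxed matching polynomial of $H$ is \[ \eta_H(x_1,\dots,x_n) = \sum_{M} (-1)^{|M|}\, W(M) \prod_{i \in [n] \setminus V(M)} x_i \in \mathbb{C}[x_1,\dots,x_n], \] where $M$ runs over all relaxed matchings of $H$, and the univariate relaxed matching polynomial is $\eta_H(x) = \eta_H(x,\dots,x)$. A polynomial $f \in \mathbb{C}[x_1,\dots,x_n]$ is called stable if $f = 0$ or $f(z_1,\dots,z_n) \neq 0$ whenever $\operatorname{Im} z_j > 0$ for all $j$.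 Then, for every hypergraph $H$, the polynomial $\eta_H(x_1,\dots,x_n)$ is stable, and, with $\partial_i = \partial/\partial x_i$, \[ \eta_H(x_1,\dots,x_n) = \left[\, \prod_{e \in E(H)} \Bigl(1 - \sum_{i \in e} \partial_i\Bigr) \prod_{i=1}^{n} (1 + \partial_i)^{\deg_H(i)} \right] x_1 x_2 \cdots x_n . \] Moreover, the univariate relaxed matching polynomial \[ \eta_H(x) = \sum_{M} (-1)^{|M|}\, W(M)\, x^{\,n - |V(M)|} \] is real-rooted, i.e. it has real coefficients and all its complex zeros are real. -/

import Mathlib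

noncomputable section

/-- A hypergraph with vertex set `[n]` (modelled by `Fin n`) and a family of hyperedges indexed
by `E`. The hyperedges are arbitrary subsets of the vertex set; an ordinary set of hyperedges is
the case of an injective `edge`. -/
structure FinHypergraph (n : ℕ) (E : Type*) where
  /-- The vertices of the hyperedge with label `e`. -/
  edge : E → Finset (Fin n)

namespace FinHypergraph

/-- The number of hyperedges that contain the vertex `i`. -/
def degree {n : ℕ} {E : Type*} [Fintype E] (H : FinHypergraph n E) (i : Fin n) : ℕ :=
  (Finset.univ.filter fun e : E => i ∈ H.edge e).card

/-- A relaxed matching `M = (S_e)_{e ∈ F}`: a set `F` of hyperedges together with pairwise disjoint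
sets `S_e ⊆ e` with more than one element, one for each `e ∈ F`. The family is stored as a function
on all of `E` that takes the value `∅` outside `F`, so that each family has one representation. -/
@[ext]
structure RelaxedMatching {n : ℕ} {E : Type*} (H : FinHypergraph n E) where
  /-- The set `F` of hyperedges that are used. -/
  edges : Finset E
  /-- The set `S_e` chosen from the hyperedge `e`. -/
  part : E → Finset (Fin n)
  part_eq_empty : ∀ e, e ∉ edges → part e = ∅
  part_subset : ∀ e ∈ edges, part e ⊆ H.edge e
  one_lt_card_part : ∀ e ∈ edges, 1 < (part e).card
  disjoint_part : ∀ e ∈ edges, ∀ e' ∈ edges, e ≠ e' → Disjoint (part e) (part e')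

namespace RelaxedMatching

instance {n : ℕ} {E : Type*} [Fintype E] (H : FinHypergraph n E) : Finite H.RelaxedMatching :=
  Finite.of_injective (β := Finset E × (E → Finset (Fin n))) (fun M => (M.edges, M.part))
    fun _ _ h => RelaxedMatching.ext (congrArg Prod.fst h) (congrArg Prod.snd h)

instance {n : ℕ} {E : Type*} [Fintype E] (H : FinHypergraph n E) : Fintype H.RelaxedMatching :=
  Fintype.ofFinite _

variable {n : ℕ} {E : Type*} {H : FinHypergraph n E}

/-- `|M|`, the number of sets in the relaxed matching. -/
def size (M : H.RelaxedMatching) : ℕ := M.edges.card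

/-- `V(M)`, the union of the sets in the relaxed matching. -/
def verts (M : H.RelaxedMatching) : Finset (Fin n) := M.edges.biUnion M.part

/-- `m_k(M)`, the number of sets of size `k` in the relaxed matching (counted with labels). -/
def sizeCount (M : H.RelaxedMatching) (k : ℕ) : ℕ :=
  (M.edges.filter fun e => (M.part e).card = k).card

/-- The weight `W(M) = ∏_{k=1}^{n-1} k ^ m_{k+1}(M)`. -/
def weight (M : H.RelaxedMatching) : ℕ :=
  ∏ k ∈ Finset.Icc 1 (n - 1), k ^ M.sizeCount (k + 1)

end RelaxedMatching

/-- The multivariate relaxed matching polynomial. -/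
def multiRelaxedMatchingPoly {n : ℕ} {E : Type*} [Fintype E] (H : FinHypergraph n E) :
    MvPolynomial (Fin n) ℂ :=
  ∑ M : H.RelaxedMatching,
    (-1) ^ M.size * (M.weight : MvPolynomial (Fin n) ℂ) * ∏ i ∈ M.vertsᶜ, MvPolynomial.X i

/-- The univariate relaxed matching polynomial: all variables of the multivariate one are set
equal to `x`. -/
def uniRelaxedMatchingPoly {n : ℕ} {E : Type*} [Fintype E] (H : FinHypergraph n E) :
    Polynomial ℂ :=
  MvPolynomial.aeval (fun _ : Fin n => (Polynomial.X : Polynomial ℂ)) H.multiRelaxedMatchingPoly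

end FinHypergraph

/-- A complex polynomial is stable if it has no zero all of whose coordinates lie in the open upper
half-plane; by convention the zero polynomial is stable. -/
def IsStablePoly {n : ℕ} (f : MvPolynomial (Fin n) ℂ) : Prop :=
  f = 0 ∨ ∀ z : Fin n → ℂ, (∀ j, 0 < (z j).im) → MvPolynomial.eval z f ≠ 0

/-- A univariate polynomial is real-rooted if its coefficients are real and all its complex zeros
are real (in particular it is not zero). -/
def IsRealRooted (p : Polynomial ℂ) : Prop :=
  (∀ k, (p.coeff k).im = 0) ∧ ∀ z : ℂ, p.IsRoot z → z.im = 0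

/-- The partial derivative `∂_i` as a linear operator on `ℂ[x_1, …, x_n]`. -/
def partialOp {n : ℕ} (i : Fin n) : Module.End ℂ (MvPolynomial (Fin n) ℂ) :=
  (MvPolynomial.pderiv i).toLinearMap

theorem partialOp_mul_comm {n : ℕ} (i j : Fin n) :
    partialOp i * partialOp j = partialOp j * partialOp i := by
  have h : ⁅MvPolynomial.pderiv (R := ℂ) i, MvPolynomial.pderiv (R := ℂ) j⁆ = 0 := by
    refine MvPolynomial.derivation_ext fun k => ?_
    rw [Derivation.commutator_apply]
    simp only [MvPolynomial.pderiv_X, Pi.single_apply]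
    split_ifs <;> simp
  refine LinearMap.ext fun p => ?_
  have hp := congrArg
    (fun D : Derivation ℂ (MvPolynomial (Fin n) ℂ) (MvPolynomial (Fin n) ℂ) => D p) h
  simp only [Derivation.commutator_apply, Derivation.coe_zero, Pi.zero_apply] at hp
  exact sub_eq_zero.mp hp

theorem isMulCommutative_adjoin_partialOp (n : ℕ) :
    IsMulCommutative (Algebra.adjoin ℂ (Set.range (partialOp (n := n)))) :=
  Algebra.isMulCommutative_adjoin ℂ (by
    rintro _ ⟨i, rfl⟩ _ ⟨j, rfl⟩
    exact partialOp_mul_comm i j)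

open scoped IsMulCommutative in
/-- Substitution of the commuting operators `∂_1, …, ∂_n` for the variables: the algebra
homomorphism `P ↦ P(∂_1, …, ∂_n)` determined by `x_i ↦ ∂_i`, with composition as the product of
operators. -/
def diffOp (n : ℕ) :
    MvPolynomial (Fin n) ℂ →ₐ[ℂ] Module.End ℂ (MvPolynomial (Fin n) ℂ) :=
  have := isMulCommutative_adjoin_partialOp n
  (Algebra.adjoin ℂ (Set.range (partialOp (n := n)))).val.comp
    (MvPolynomial.aeval fun i =>
      (⟨partialOp i, Algebra.subset_adjoin ⟨i, rfl⟩⟩ :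
        Algebra.adjoin ℂ (Set.range (partialOp (n := n)))))

theorem diffOp_X {n : ℕ} (i : Fin n) : diffOp n (MvPolynomial.X i) = partialOp i := by
  simp [diffOp]

end

/-! Every `∂_i ^ 2` kills `x_1 ⋯ x_n`, so only the symbol modulo the squares of the variables
matters. Distributing the factors `1 + y_i` over the hyperedges gives each `e` the factor `(1 - ∑
y_i) ∏ (1 + y_i) = ∑_{t ⊆ e} (1 - |t|) y^t`, because `y^t` arises in `(∑ y_i) ∏ (1 + y_i)` once for
each `i ∈ t`. In the product over `e`, singletons have coefficient zero and overlapping choices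
contain a square; what survives is the sum over relaxed matchings (`prod_symbol_eq_sum`).

For stability, each operator `1 + a ∑_{i ∈ s} ∂_i` with `a` real preserves non-vanishing on the
upper half-planes: on a line it becomes `g + a g'`, controlled by the logarithmic derivative
(`eval_add_mul_derivative_ne_zero`). Real-rootedness follows on the diagonal by conjugation. -/

theorem one_sub_sum_mul_prod_one_add {ι R : Type*} [CommRing R] (y : ι → R)
    (hy : ∀ i, y i ^ 2 = 0) (s : Finset ι) :
    (1 - ∑ i ∈ s, y i) * ∏ i ∈ s, (1 + y i) =
      ∑ t ∈ s.powerset, (1 - (t.card : R)) * ∏ i ∈ t, y i := by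
  classical
  induction s using Finset.induction_on with
  | empty => simp
  | insert a s ha ih =>
    have hsum : ∑ t ∈ s.powerset, (1 - ((insert a t).card : R)) * ∏ i ∈ insert a t, y i =
        y a * (∑ t ∈ s.powerset, (1 - (t.card : R)) * ∏ i ∈ t, y i) -
          y a * ∏ i ∈ s, (1 + y i) := by
      rw [Finset.prod_one_add, ← mul_sub, ← Finset.sum_sub_distrib, Finset.mul_sum]
      refine Finset.sum_congr rfl fun t ht => ?_
      have hat : a ∉ t := fun h => ha (Finset.mem_powerset.mp ht h)
      rw [Finset.card_insert_of_notMem hat, Finset.prod_insert hat]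
      push_cast
      ring
    rw [Finset.sum_powerset_insert ha, hsum, ← ih, Finset.sum_insert ha, Finset.prod_insert ha]
    -- The two sides differ only by the term in `y a ^ 2`.
    linear_combination (-∏ i ∈ s, (1 + y i)) * hy a

theorem prod_prod_eq_zero_of_not_disjoint {ι κ R : Type*} [CommRing R] (y : ι → R)
    (hy : ∀ i, y i ^ 2 = 0) [Fintype κ] (t : κ → Finset ι) {e e' : κ} (hne : e ≠ e')
    (h : ¬ Disjoint (t e) (t e')) : ∏ k, ∏ i ∈ t k, y i = 0 := by
  classical
  obtain ⟨i, hi, hi'⟩ := Finset.not_disjoint_iff.mp h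
  have h1 : (∏ i ∈ t e, y i) * ∏ i ∈ t e', y i = 0 := by
    rw [← Finset.mul_prod_erase _ _ hi, ← Finset.mul_prod_erase _ _ hi']
    linear_combination ((∏ j ∈ (t e).erase i, y j) * ∏ j ∈ (t e').erase i, y j) * hy i
  rw [← Finset.mul_prod_erase _ _ (Finset.mem_univ e),
    ← Finset.mul_prod_erase _ _ (Finset.mem_erase.mpr ⟨hne.symm, Finset.mem_univ e'⟩),
    ← mul_assoc, h1, zero_mul]

/-! ### Differential operators acting on the product of all variables -/

theorem partialOp_prod_X_of_notMem {n : ℕ} {i : Fin n} {s : Finset (Fin n)} (hi : i ∉ s) :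
    partialOp i (∏ j ∈ s, MvPolynomial.X j) = 0 := by
  induction s using Finset.induction_on with
  | empty => simp [partialOp]
  | insert a s ha ih =>
    rw [Finset.mem_insert, not_or] at hi
    have := ih hi.2
    simp only [partialOp, Derivation.coeFn_coe] at this ⊢
    rw [Finset.prod_insert ha, Derivation.leibniz, this, MvPolynomial.pderiv_X_of_ne (Ne.symm hi.1)]
    simp

theorem partialOp_prod_X_of_mem {n : ℕ} {i : Fin n} {s : Finset (Fin n)} (hi : i ∈ s) :
    partialOp i (∏ j ∈ s, MvPolynomial.X j) = ∏ j ∈ s.erase i, MvPolynomial.X j := by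
  have := partialOp_prod_X_of_notMem (Finset.notMem_erase i s)
  rw [← Finset.mul_prod_erase _ _ hi]
  simp only [partialOp, Derivation.coeFn_coe] at this ⊢
  rw [Derivation.leibniz, this, MvPolynomial.pderiv_X_self]
  simp

theorem diffOp_prod_X {n : ℕ} (s : Finset (Fin n)) :
    diffOp n (∏ i ∈ s, MvPolynomial.X i) (∏ i, MvPolynomial.X i) =
      ∏ i ∈ sᶜ, MvPolynomial.X i := by
  induction s using Finset.induction_on with
  | empty => simp
  | insert a s ha ih =>
    rw [Finset.prod_insert ha, map_mul, Module.End.mul_apply, ih, diffOp_X,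
      partialOp_prod_X_of_mem (by simpa using ha), Finset.compl_insert]

/-- The ideal generated by the squares of the variables. -/
noncomputable def squaresIdeal (n : ℕ) : Ideal (MvPolynomial (Fin n) ℂ) :=
  Ideal.span (Set.range fun i => MvPolynomial.X i ^ 2)

theorem mk_X_sq {n : ℕ} (i : Fin n) :
    (Ideal.Quotient.mk (squaresIdeal n) (MvPolynomial.X i)) ^ 2 = 0 := by
  rw [← map_pow]
  exact Ideal.Quotient.eq_zero_iff_mem.mpr (Ideal.subset_span ⟨i, rfl⟩)

theorem diffOp_prod_X_eq_zero_of_mem {n : ℕ} {P : MvPolynomial (Fin n) ℂ}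
    (hP : P ∈ squaresIdeal n) : diffOp n P (∏ i, MvPolynomial.X i) = 0 := by
  induction hP using Submodule.span_induction with
  | mem x hx =>
    obtain ⟨i, rfl⟩ := hx
    rw [map_pow, sq, Module.End.mul_apply, diffOp_X,
      partialOp_prod_X_of_mem (Finset.mem_univ i),
      partialOp_prod_X_of_notMem (Finset.notMem_erase i _)]
  | zero => simp
  | add x y _ _ hx hy => rw [map_add, LinearMap.add_apply, hx, hy, add_zero]
  | smul a x _ hx => rw [smul_eq_mul, map_mul, Module.End.mul_apply, hx, map_zero]

theorem diffOp_prod_X_congr {n : ℕ} {P Q : MvPolynomial (Fin n) ℂ}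
    (h : Ideal.Quotient.mk (squaresIdeal n) P = Ideal.Quotient.mk (squaresIdeal n) Q) :
    diffOp n P (∏ i, MvPolynomial.X i) = diffOp n Q (∏ i, MvPolynomial.X i) := by
  rw [← sub_eq_zero, ← LinearMap.sub_apply, ← map_sub]
  exact diffOp_prod_X_eq_zero_of_mem (Ideal.Quotient.eq.mp h)

/-! ### Expansion over relaxed matchings -/

namespace FinHypergraph

variable {n : ℕ} {E : Type*}

theorem prod_pow_degree [Fintype E] (H : FinHypergraph n E) {R : Type*} [CommMonoid R]
    (y : Fin n → R) : ∏ i, y i ^ H.degree i = ∏ e, ∏ i ∈ H.edge e, y i := by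
  simp only [degree, ← Finset.prod_const]
  exact Finset.prod_comm' (by simp)

namespace RelaxedMatching

variable {H : FinHypergraph n E}

theorem mem_edges_iff (M : H.RelaxedMatching) (e : E) : e ∈ M.edges ↔ M.part e ≠ ∅ := by
  refine ⟨fun h h0 => ?_, fun h => by_contra fun h' => h (M.part_eq_empty e h')⟩
  have := M.one_lt_card_part e h
  simp [h0] at this

theorem part_injective : Function.Injective (part : H.RelaxedMatching → E → Finset (Fin n)) :=
  fun M N h => RelaxedMatching.ext (by ext e; rw [mem_edges_iff, mem_edges_iff, h]) h

theorem weight_eq_prod (M : H.RelaxedMatching) :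
    M.weight = ∏ e ∈ M.edges, ((M.part e).card - 1) := by
  classical
  rw [← Finset.prod_fiberwise_of_maps_to (s := M.edges) (t := Finset.Icc 1 (n - 1))
    (g := fun e => (M.part e).card - 1), weight]
  · refine Finset.prod_congr rfl fun k hk => ?_
    rw [sizeCount, ← Finset.prod_const]
    have hf : (M.edges.filter fun e => (M.part e).card = k + 1) =
        M.edges.filter fun e => (M.part e).card - 1 = k := by
      refine Finset.filter_congr fun e he => ?_
      have := M.one_lt_card_part e he
      omega
    rw [hf]
    exact Finset.prod_congr rfl fun e he => (Finset.mem_filter.mp he).2.symm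
  · intro e he
    have h1 := M.one_lt_card_part e he
    have h2 := Finset.card_le_univ (M.part e)
    rw [Fintype.card_fin] at h2
    exact Finset.mem_Icc.mpr ⟨by omega, by omega⟩

/-- An unused hyperedge has empty part and contributes `1 - 0 = 1`, so the product may run over all
of `E`. -/
theorem sign_mul_weight [Fintype E] {R : Type*} [CommRing R] (M : H.RelaxedMatching) :
    (-1) ^ M.size * (M.weight : R) = ∏ e, (1 - ((M.part e).card : R)) := by
  rw [weight_eq_prod, size, ← Finset.prod_const, Nat.cast_prod, ← Finset.prod_mul_distrib]
  rw [← Finset.prod_subset (Finset.subset_univ M.edges)]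
  · refine Finset.prod_congr rfl fun e he => ?_
    rw [Nat.cast_sub (M.one_lt_card_part e he).le]
    push_cast
    ring
  · intro e _ he
    simp [M.part_eq_empty e he]

theorem disjoint_part_of_ne (M : H.RelaxedMatching) {e e' : E} (h : e ≠ e') :
    Disjoint (M.part e) (M.part e') := by
  by_cases he : e ∈ M.edges
  · by_cases he' : e' ∈ M.edges
    · exact M.disjoint_part e he e' he' h
    · simp [M.part_eq_empty e' he']
  · simp [M.part_eq_empty e he]

theorem prod_verts [Fintype E] {R : Type*} [CommMonoid R] (M : H.RelaxedMatching)
    (y : Fin n → R) : ∏ i ∈ M.verts, y i = ∏ e, ∏ i ∈ M.part e, y i := by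
  classical
  rw [verts, Finset.prod_biUnion fun e _ e' _ h => M.disjoint_part_of_ne h]
  refine Finset.prod_subset (Finset.subset_univ _) fun e _ he => ?_
  simp [M.part_eq_empty e he]

end RelaxedMatching

/-- Modulo the squares of the variables, the product of the hyperedge symbols is the generating
polynomial of the relaxed matchings. -/
theorem prod_symbol_eq_sum [Fintype E] (H : FinHypergraph n E) {R : Type*} [CommRing R]
    (y : Fin n → R) (hy : ∀ i, y i ^ 2 = 0) :
    (∏ e : E, (1 - ∑ i ∈ H.edge e, y i)) * ∏ i, (1 + y i) ^ H.degree i =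
      ∑ M : H.RelaxedMatching, (-1) ^ M.size * (M.weight : R) * ∏ i ∈ M.verts, y i := by
  classical
  rw [prod_pow_degree, ← Finset.prod_mul_distrib]
  simp only [one_sub_sum_mul_prod_one_add y hy]
  rw [Finset.prod_univ_sum]
  symm
  refine Finset.sum_of_injOn RelaxedMatching.part RelaxedMatching.part_injective.injOn ?_ ?_ ?_
  · intro M _
    simp only [Finset.mem_coe, Fintype.mem_piFinset, Finset.mem_powerset]
    intro e
    by_cases he : e ∈ M.edges
    · exact M.part_subset e he
    · simp [M.part_eq_empty e he]
  · intro t ht hM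
    rw [Finset.prod_mul_distrib]
    by_contra hne
    -- A choice `t` with nonzero term is itself a relaxed matching, with `∅` marking the unused
    -- hyperedges.
    refine hM ⟨⟨Finset.univ.filter fun e => t e ≠ ∅, t, ?_, ?_, ?_, ?_⟩, by simp, rfl⟩
    · intro e he
      simpa using he
    · intro e _
      exact Finset.mem_powerset.mp (Fintype.mem_piFinset.mp ht e)
    · intro e he
      have h0 : (t e).card ≠ 0 := by simpa using he
      have h1 : (t e).card ≠ 1 := fun h1 => hne <| by
        rw [Finset.prod_eq_zero (Finset.mem_univ e) (by simp [h1]), zero_mul]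
      omega
    · intro e _ e' _ hee
      by_contra h
      exact hne (by rw [prod_prod_eq_zero_of_not_disjoint y hy t hee h, mul_zero])
  · intro M _
    rw [Finset.prod_mul_distrib, M.sign_mul_weight, M.prod_verts]

theorem multiRelaxedMatchingPoly_eq_diffOp [Fintype E] (H : FinHypergraph n E) :
    H.multiRelaxedMatchingPoly =
      diffOp n ((∏ e : E, (1 - ∑ i ∈ H.edge e, MvPolynomial.X i)) *
        ∏ i : Fin n, (1 + MvPolynomial.X i) ^ H.degree i) (∏ i : Fin n, MvPolynomial.X i) := by
  have h := H.prod_symbol_eq_sum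
    (fun i => Ideal.Quotient.mk (squaresIdeal n) (MvPolynomial.X i)) mk_X_sq
  rw [diffOp_prod_X_congr (Q := ∑ M : H.RelaxedMatching,
    (-1) ^ M.size * (M.weight : MvPolynomial (Fin n) ℂ) * ∏ i ∈ M.verts, MvPolynomial.X i)
    (by simpa using h)]
  rw [map_sum, LinearMap.sum_apply, multiRelaxedMatchingPoly]
  refine Finset.sum_congr rfl fun M _ => ?_
  rw [map_mul, Module.End.mul_apply, diffOp_prod_X]
  have hc : (-1) ^ M.size * (M.weight : MvPolynomial (Fin n) ℂ) =
      algebraMap ℂ _ ((-1) ^ M.size * (M.weight : ℂ)) := by simp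
  rw [hc, AlgHom.commutes, Module.algebraMap_end_apply, Algebra.smul_def]

end FinHypergraph

/-! ### Stability preservers -/

/-- As in Gauss–Lucas, `g'/g` at `z` is the sum of `1 / (z - w)` over the roots, each term with
negative imaginary part. A real multiple of such a sum is never `-1`. -/
theorem eval_add_mul_derivative_ne_zero {g : Polynomial ℂ} {z : ℂ}
    (hz : g.eval z ≠ 0) (hg : ∀ w, g.IsRoot w → w.im < z.im) (a : ℝ) :
    g.eval z + a * g.derivative.eval z ≠ 0 := by
  have hs := (IsAlgClosed.splits g).eval_derivative_div_eval_of_ne_zero hz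
  intro h
  have h1 : 1 + a * (g.derivative.eval z / g.eval z) = 0 := by
    field_simp
    linear_combination h
  rw [hs] at h1
  have him : ∀ w ∈ g.roots, (1 / (z - w)).im < 0 := by
    intro w hw
    have hw' := hg w (Polynomial.isRoot_of_mem_roots hw)
    have hpos : 0 < (z - w).im := by simpa using hw'
    have hne : z - w ≠ 0 := fun h0 => by simp [h0] at hpos
    rw [one_div, Complex.inv_im]
    exact div_neg_of_neg_of_pos (by linarith) (Complex.normSq_pos.mpr hne)
  have hsum : (g.roots.map fun w => 1 / (z - w)).sum.im =
      (g.roots.map fun w => (1 / (z - w)).im).sum := by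
    have := map_multiset_sum Complex.imAddGroupHom (g.roots.map fun w => 1 / (z - w))
    simpa [Multiset.map_map, Function.comp_def] using this
  -- Without roots the sum is zero and the strict inequality fails, but then `h1` reads `1 = 0`.
  rcases eq_or_ne g.roots 0 with h0 | h0
  · simp [h0] at h1
  · have hneg : (g.roots.map fun w => (1 / (z - w)).im).sum < 0 := by
      have := Multiset.sum_lt_sum_of_nonempty (f := fun w => (1 / (z - w)).im)
        (g := fun _ => (0 : ℝ)) h0 him
      simpa using this
    rw [← hsum] at hneg
    have hi := congrArg Complex.im h1
    have hr := congrArg Complex.re h1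
    simp only [Complex.add_im, Complex.one_im, Complex.re_ofReal_mul, Complex.im_ofReal_mul,
      Complex.add_re, Complex.one_re, Complex.zero_im, Complex.zero_re, zero_add, mul_eq_zero] at hi hr
    rcases hi with hi | hi
    · simp [hi] at hr
    · exact hneg.ne hi

/-- Non-vanishing on the product of open upper half-planes. -/
def NonvanishingOnUpper {n : ℕ} (f : MvPolynomial (Fin n) ℂ) : Prop :=
  ∀ z : Fin n → ℂ, (∀ j, 0 < (z j).im) → MvPolynomial.eval z f ≠ 0

/-- The restriction of `f` to the line through `z` in the direction of the indicator of `s`. -/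
noncomputable def lineRestriction {n : ℕ} (s : Finset (Fin n)) (z : Fin n → ℂ) :
    MvPolynomial (Fin n) ℂ →ₐ[ℂ] Polynomial ℂ :=
  MvPolynomial.aeval fun i => Polynomial.C (z i) + if i ∈ s then Polynomial.X else 0

theorem eval_lineRestriction {n : ℕ} (s : Finset (Fin n)) (z : Fin n → ℂ) (t : ℂ)
    (f : MvPolynomial (Fin n) ℂ) :
    (lineRestriction s z f).eval t =
      MvPolynomial.eval (fun i => z i + if i ∈ s then t else 0) f := by
  induction f using MvPolynomial.induction_on with
  | C a => simp [lineRestriction]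
  | add p q hp hq => simp [hp, hq]
  | mul_X p i hp =>
    rw [map_mul, Polynomial.eval_mul, hp, map_mul]
    congr 1
    by_cases h : i ∈ s <;> simp [lineRestriction, h]

theorem derivative_lineRestriction {n : ℕ} (s : Finset (Fin n)) (z : Fin n → ℂ)
    (f : MvPolynomial (Fin n) ℂ) :
    (lineRestriction s z f).derivative = lineRestriction s z (∑ i ∈ s, partialOp i f) := by
  induction f using MvPolynomial.induction_on with
  | C a => simp [lineRestriction, partialOp]
  | add p q hp hq => simp [hp, hq, Finset.sum_add_distrib]
  | mul_X p k hp =>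
    have h1 : ∑ i ∈ s, partialOp i (p * MvPolynomial.X k) =
        (∑ i ∈ s, partialOp i p) * MvPolynomial.X k + if k ∈ s then p else 0 := by
      rw [Finset.sum_mul]
      simp only [partialOp, Derivation.coeFn_coe, Derivation.leibniz, smul_eq_mul,
        MvPolynomial.pderiv_X, Finset.sum_add_distrib, Pi.single_apply, mul_ite, mul_one, mul_zero]
      rw [add_comm]
      congr 1
      · exact Finset.sum_congr rfl fun i _ => mul_comm _ _
      · simp
    rw [h1, map_mul, Polynomial.derivative_mul, hp, map_add, map_mul]
    congr 1
    by_cases h : k ∈ s <;> simp [lineRestriction, h]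

theorem NonvanishingOnUpper.add_smul_sum_partialOp {n : ℕ} {f : MvPolynomial (Fin n) ℂ}
    (hf : NonvanishingOnUpper f) (a : ℝ) (s : Finset (Fin n)) :
    NonvanishingOnUpper (f + (a : ℂ) • ∑ i ∈ s, partialOp i f) := by
  intro z hz
  have he : ∀ p, MvPolynomial.eval z p = (lineRestriction s z p).eval 0 := fun p => by
    rw [eval_lineRestriction]
    simp
  have h0 := hf z hz
  rw [he] at h0
  rw [map_add, MvPolynomial.smul_eval, he, he, ← derivative_lineRestriction]
  refine eval_add_mul_derivative_ne_zero h0 (fun w hw => ?_) a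
  -- A root `w` with `0 ≤ w.im` would only move coordinates further up, giving a zero of `f` in the
  -- upper half-planes.
  by_contra hge
  rw [Complex.zero_im, not_lt] at hge
  rw [Polynomial.IsRoot, eval_lineRestriction] at hw
  refine hf _ (fun j => ?_) hw
  have := hz j
  split_ifs
  · rw [Complex.add_im]
    linarith
  · simpa using this

theorem nonvanishingOnUpper_prod_X (n : ℕ) :
    NonvanishingOnUpper (∏ i : Fin n, MvPolynomial.X i) := by
  intro z hz
  rw [map_prod]
  refine Finset.prod_ne_zero_iff.mpr fun i _ h => ?_
  have := hz i
  rw [MvPolynomial.eval_X] at h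
  simp [h] at this

/-- The symbols of differential operators that preserve non-vanishing. -/
def nonvanishingPreservers (n : ℕ) : Submonoid (MvPolynomial (Fin n) ℂ) where
  carrier := {P | ∀ f, NonvanishingOnUpper f → NonvanishingOnUpper (diffOp n P f)}
  one_mem' f hf := by simpa using hf
  mul_mem' {P Q} hP hQ f hf := by
    rw [map_mul, Module.End.mul_apply]
    exact hP _ (hQ f hf)

theorem one_sub_sum_X_mem_nonvanishingPreservers {n : ℕ} (s : Finset (Fin n)) :
    1 - ∑ i ∈ s, MvPolynomial.X i ∈ nonvanishingPreservers n := by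
  intro f hf
  have := hf.add_smul_sum_partialOp (-1) s
  simpa [diffOp_X, sub_eq_add_neg] using this

theorem one_add_X_mem_nonvanishingPreservers {n : ℕ} (i : Fin n) :
    1 + MvPolynomial.X i ∈ nonvanishingPreservers n := by
  intro f hf
  have := hf.add_smul_sum_partialOp 1 {i}
  simpa [diffOp_X] using this

/-! ### Stability and real-rootedness -/

namespace FinHypergraph

variable {n : ℕ} {E : Type*} [Fintype E] (H : FinHypergraph n E)

theorem nonvanishingOnUpper_multiRelaxedMatchingPoly :
    NonvanishingOnUpper H.multiRelaxedMatchingPoly := by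
  rw [multiRelaxedMatchingPoly_eq_diffOp]
  refine mul_mem (prod_mem fun e _ => one_sub_sum_X_mem_nonvanishingPreservers _)
    (prod_mem fun i _ => pow_mem (one_add_X_mem_nonvanishingPreservers i) _) _
    (nonvanishingOnUpper_prod_X n)

theorem uniRelaxedMatchingPoly_eq_sum :
    H.uniRelaxedMatchingPoly =
      ∑ M : H.RelaxedMatching,
        (-1) ^ M.size * (M.weight : Polynomial ℂ) * Polynomial.X ^ (n - M.verts.card) := by
  rw [uniRelaxedMatchingPoly, multiRelaxedMatchingPoly, map_sum]
  refine Finset.sum_congr rfl fun M _ => ?_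
  simp [Finset.card_compl]

theorem exists_real_map_eq_uniRelaxedMatchingPoly :
    ∃ p : Polynomial ℝ, H.uniRelaxedMatchingPoly = p.map (algebraMap ℝ ℂ) :=
  ⟨∑ M : H.RelaxedMatching,
    (-1) ^ M.size * (M.weight : Polynomial ℝ) * Polynomial.X ^ (n - M.verts.card), by
    simp [uniRelaxedMatchingPoly_eq_sum, Polynomial.map_sum]⟩

theorem not_isRoot_uniRelaxedMatchingPoly {z : ℂ} (hz : 0 < z.im) :
    ¬ H.uniRelaxedMatchingPoly.IsRoot z := by
  have h : H.uniRelaxedMatchingPoly.eval z =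
      MvPolynomial.eval (fun _ => z) H.multiRelaxedMatchingPoly := by
    rw [uniRelaxedMatchingPoly, ← Polynomial.coe_aeval_eq_eval,
      ← AlgHom.comp_apply, MvPolynomial.comp_aeval, ← MvPolynomial.aeval_eq_eval]
    simp
  rw [Polynomial.IsRoot, h]
  exact H.nonvanishingOnUpper_multiRelaxedMatchingPoly _ fun _ => hz

theorem isRealRooted_uniRelaxedMatchingPoly : IsRealRooted H.uniRelaxedMatchingPoly := by
  obtain ⟨p, hp⟩ := H.exists_real_map_eq_uniRelaxedMatchingPoly
  refine ⟨fun k => by simp [hp], fun z hz => ?_⟩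
  rcases lt_trichotomy z.im 0 with h | h | h
  -- Real coefficients make the conjugate a root as well, now in the upper half-plane.
  · refine (H.not_isRoot_uniRelaxedMatchingPoly (z := starRingEnd ℂ z) (by simpa using h) ?_).elim
    rw [hp, Polynomial.IsRoot, Polynomial.eval_map_algebraMap] at hz ⊢
    rw [Polynomial.aeval_conj, hz, map_zero]
  · exact h
  · exact (H.not_isRoot_uniRelaxedMatchingPoly h hz).elim

end FinHypergraph

theorem mainTheorem7 {n : ℕ} {E : Type*} [Fintype E] (H : FinHypergraph n E) :
    IsStablePoly H.multiRelaxedMatchingPoly ∧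
    H.multiRelaxedMatchingPoly =
      diffOp n ((∏ e : E, (1 - ∑ i ∈ H.edge e, MvPolynomial.X i)) *
        ∏ i : Fin n, (1 + MvPolynomial.X i) ^ H.degree i) (∏ i : Fin n, MvPolynomial.X i) ∧
    H.uniRelaxedMatchingPoly =
      ∑ M : H.RelaxedMatching,
        (-1) ^ M.size * (M.weight : Polynomial ℂ) * Polynomial.X ^ (n - M.verts.card) ∧
    IsRealRooted H.uniRelaxedMatchingPoly :=
  ⟨Or.inr H.nonvanishingOnUpper_multiRelaxedMatchingPoly, H.multiRelaxedMatchingPoly_eq_diffOp,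
    H.uniRelaxedMatchingPoly_eq_sum, H.isRealRooted_uniRelaxedMatchingPoly⟩
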